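/- Let $n\ge 1$ be an integer. An $n$-th tropical meromorphic function is a continuous function $f:\mathbb R\to\mathbb R$ for which there are a strictly increasing sequence $(x_i)_{i\in\mathbb Z}$ in $\mathbb R$ without finite accumulation point and real polynomials $f_i$ with $f=f_i$ on $[x_{i-1},x_i]$ for all $i\in\mathbb Z$ and $\max_i\deg f_i=n$. It is called well defined if for every $i$ the non-constant monomials occurring in $f_i$ all have degree of the same parity as $\deg f_i$ and their coefficients are all non-negative or all non-positive (so constant pieces are allowed). For $x\in\mathbb R$ and $1\le j\le n$ put $$\omega_f^{(j)}(x)=\frac{\operatorname{sgn}^{j+1}(x^+)f^{(j)}(x^+)-\operatorname{sgn}^{j+1}(x^-)f^{(j)}(x^-)}{j!},$$ where $f^{(j)}(x^{\pm})$ are the one-sided limits of $f^{(j)}$ at $x$, and likewise $\operatorname{sgn}(x^{\pm})$ are the one-sided limits of $\operatorname{sgn}$ at $x$, so that $\operatorname{sgn}(0^{\pm})=\pm1$. A point $z$ with $\omega_f^{(j)}(z)<0$ is a $j$-th pole of $f$. For $r>0$ put $$m(r,f)=\frac{\max\{f(r),0\}+\max\{f(-r),0\}}{2},\qquad N^{(j)}(r,f)=\frac12\sum_{|z|<r,\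 \omega_f^{(j)}(z)<0}\bigl|\omega_f^{(j)}(z)\bigr|\,(r-|z|)^j,$$ $$T(r,f)=m(r,f)+\sum_{j=1}^nN^{(j)}(r,f),\qquad \rho_2(f)=\limsup_{r\to\infty}\frac{\log\log T(r,f)}{\log r}\in[-\infty,\infty].$$ Let $c\neq0$ be a real number and let $f$ be a well defined $n$-th tropical meromorphic function with $\rho_2(f)<1$. Then for every $\sigma\in(0,1-\rho_2(f))$ there is a measurable set $E\subset[1,\infty)$ of finite logarithmic measure, $\int_E\frac{dr}{r}<\infty$, such that $$m\bigl(r,\,f(x+c)\oslash f(x)\bigr)=o\!\left(\frac{T(r,f)}{r^{\sigma}}\right)\qquad\text{as } r\to\infty,\ r\notin E,$$ where $f(x+c)\oslash f(x)$ is the function $x\mapsto f(x+c)-f(x)$, and $m$ of it is given by the same formula as above. -/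

import Mathlib

open Filter Topology MeasureTheory

namespace TropicalNevanlinna

/-- `f` is the continuous piecewise polynomial function with breakpoints `x i` and polynomial
pieces `p i` on `[x (i - 1), x i]`, `i ∈ ℤ`, the maximum of the degrees of the pieces being `n`.
A strictly increasing sequence indexed by `ℤ` has no finite accumulation point exactly when it tends
to `±∞` at the two ends. Breakpoints at which two neighbouring pieces coincide are allowed. -/
structure IsPiecewisePolynomial (n : ℕ) (f : ℝ → ℝ) (x : ℤ → ℝ) (p : ℤ → Polynomial ℝ) :
    Prop where
  strictMono : StrictMono x
  tendsto_atTop : Tendsto x atTop atTop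
  tendsto_atBot : Tendsto x atBot atBot
  continuous : Continuous f
  eqOn : ∀ i : ℤ, ∀ t ∈ Set.Icc (x (i - 1)) (x i), f t = (p i).eval t
  natDegree_le : ∀ i : ℤ, (p i).natDegree ≤ n
  exists_natDegree_eq : ∃ i : ℤ, (p i).natDegree = n

/-- `n`-th tropical meromorphic functions on `ℝ` (used for `n ≥ 1`). -/
def IsTropicalMeromorphic (n : ℕ) (f : ℝ → ℝ) : Prop :=
  ∃ (x : ℤ → ℝ) (p : ℤ → Polynomial ℝ), IsPiecewisePolynomial n f x p

/-- A polynomial is well defined if, apart from the constant term, only the powers of the same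
parity as its degree occur, and their coefficients are all `≥ 0` or all `≤ 0`.
Constants are well defined. -/
def IsWellDefinedPolynomial (p : Polynomial ℝ) : Prop :=
  (∀ j : ℕ, 1 ≤ j → j % 2 ≠ p.natDegree % 2 → p.coeff j = 0) ∧
    ((∀ j : ℕ, 1 ≤ j → 0 ≤ p.coeff j) ∨ (∀ j : ℕ, 1 ≤ j → p.coeff j ≤ 0))

/-- Well defined `n`-th tropical meromorphic functions: every polynomial piece is well defined. -/
def IsWellDefinedTropicalMeromorphic (n : ℕ) (f : ℝ → ℝ) : Prop :=
  ∃ (x : ℤ → ℝ) (p : ℤ → Polynomial ℝ), IsPiecewisePolynomial n f x p ∧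
    ∀ i : ℤ, IsWellDefinedPolynomial (p i)

/-- Tropical quotient `f ⊘ g`. -/
def tropicalDiv (f g : ℝ → ℝ) : ℝ → ℝ := fun x => f x - g x

/-- `sgn (x⁺)`; in particular `sgn (0⁺) = 1`. -/
noncomputable def sgnRight (x : ℝ) : ℝ := if 0 ≤ x then 1 else -1

/-- `sgn (x⁻)`; in particular `sgn (0⁻) = -1`. -/
noncomputable def sgnLeft (x : ℝ) : ℝ := if 0 < x then 1 else -1

/-- `ω_f^{(j)}(x)`, where `f^{(j)}(x^±)` is the one-sided limit of the `j`-th derivative. -/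
noncomputable def omega (f : ℝ → ℝ) (j : ℕ) (x : ℝ) : ℝ :=
  (sgnRight x ^ (j + 1) * Function.rightLim (iteratedDeriv j f) x
    - sgnLeft x ^ (j + 1) * Function.leftLim (iteratedDeriv j f) x) / (j.factorial : ℝ)

/-- The `j`-th poles of `f`. -/
def poles (f : ℝ → ℝ) (j : ℕ) : Set ℝ := {z | omega f j z < 0}

/-- Max-plus proximity function `m(r, f)`. -/
noncomputable def proximity (r : ℝ) (f : ℝ → ℝ) : ℝ :=
  (max (f r) 0 + max (f (-r)) 0) / 2

/-- `j`-th integrated max-plus counting function `N^{(j)}(r, f)`. For a piecewise polynomial `f`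
the poles lie among the breakpoints and `0`, so the sum is finite. -/
noncomputable def counting (j : ℕ) (r : ℝ) (f : ℝ → ℝ) : ℝ :=
  (1 / 2) * ∑ᶠ z ∈ poles f j ∩ Set.Ioo (-r) r, |omega f j z| * (r - |z|) ^ j

/-- `n`-th max-plus characteristic function `T(r, f)`. -/
noncomputable def characteristic (n : ℕ) (r : ℝ) (f : ℝ → ℝ) : ℝ :=
  proximity r f + ∑ j ∈ Finset.Icc 1 n, counting j r f

/-- Hyper-order `ρ₂(f)`, an extended real number. -/
noncomputable def hyperOrder (n : ℕ) (f : ℝ → ℝ) : EReal :=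
  limsup (fun r : ℝ =>
    ((Real.log (Real.log (characteristic n r f)) / Real.log r : ℝ) : EReal)) atTop

/-- `E ⊆ [1, ∞)` is measurable with `∫_E dr / r < ∞`. -/
def HasFiniteLogMeasure (E : Set ℝ) : Prop :=
  MeasurableSet E ∧ E ⊆ Set.Ici 1 ∧ ∫⁻ r in E, ENNReal.ofReal (1 / r) < ⊤

end TropicalNevanlinna

namespace TropicalNevanlinna

/-! ### One-sided derivatives as Taylor coefficients; location of points among the breakpoints. -/

open Polynomial Function

/-! For `t ≥ 0` the function is a sum of truncated powers: `f (±t)` is `f 0`, plus `±½ ∑ oddCoeff f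
j * t ^ j`, plus `omega f j z * (t - |z|)₊ ^ j` over the jumps on that side, jumps at `0` being
shared equally (`representation`, `representation_neg`).

Adding the two expansions cancels the odd part and gives Jensen's formula. It bounds the sum of all
`|omega f j z| * (r - |z|)₊ ^ j` by `4T + 2|f 0|`, and then `|f (±r)|` by a multiple of `T + |f 0|`.
Subtracting them isolates the odd polynomial, which at infinity is comparable to the sum of the
absolute values of its terms. Hence `majorant`, the expansion with absolute values, is monotone and
`O(T)`.

Convexity of `u ^ j` turns the expansion into `|f t - f s| ≤ (t - s) / (R - t) * majorant n f R`.
With `R = r + r ^ s`, `ρ₂ < τ` and `σ < s < 1 - τ`, a Borel-type lemma gives `majorant n f R ≤ 2 *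
majorant n f r` off a set of finite logarithmic measure, so the proximity function there is `O(T / r
^ s) = o(T / r ^ σ)`. -/

theorem iteratedDeriv_polynomial_eval (q : ℝ[X]) (j : ℕ) :
    iteratedDeriv j (fun t => q.eval t) = fun t => (derivative^[j] q).eval t := by
  induction j with
  | zero => simp
  | succ j ih =>
    rw [iteratedDeriv_succ, ih]
    funext t
    rw [Polynomial.deriv, Function.iterate_succ_apply']

theorem iterate_derivative_eval_eq_taylor_coeff (q : ℝ[X]) (j : ℕ) (z : ℝ) :
    (derivative^[j] q).eval z = (j.factorial : ℝ) * (taylor z q).coeff j := by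
  rw [taylor_coeff, ← factorial_smul_hasseDeriv]
  simp [eval_mul, nsmul_eq_mul]

theorem rightLim_iteratedDeriv {f : ℝ → ℝ} {q : ℝ[X]} {a b : ℝ} (hab : a < b)
    (h : ∀ t ∈ Set.Ioo a b, f t = q.eval t) (j : ℕ) :
    rightLim (iteratedDeriv j f) a = (j.factorial : ℝ) * (taylor a q).coeff j := by
  rw [← iterate_derivative_eval_eq_taylor_coeff]
  apply rightLim_eq_of_tendsto
  have hc : Tendsto (fun t => (derivative^[j] q).eval t) (𝓝[>] a)
      (𝓝 ((derivative^[j] q).eval a)) :=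
    ((derivative^[j] q).continuous.tendsto a).mono_left nhdsWithin_le_nhds
  refine hc.congr' ?_
  filter_upwards [Ioo_mem_nhdsGT hab] with t ht
  have h2 := Set.EqOn.iteratedDeriv_of_isOpen (f := f) (g := fun t => q.eval t)
    (s := Set.Ioo a b) h isOpen_Ioo j ht
  rw [h2, iteratedDeriv_polynomial_eval]

theorem leftLim_iteratedDeriv {f : ℝ → ℝ} {q : ℝ[X]} {a b : ℝ} (hab : a < b)
    (h : ∀ t ∈ Set.Ioo a b, f t = q.eval t) (j : ℕ) :
    leftLim (iteratedDeriv j f) b = (j.factorial : ℝ) * (taylor b q).coeff j := by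
  rw [← iterate_derivative_eval_eq_taylor_coeff]
  apply leftLim_eq_of_tendsto
  have hc : Tendsto (fun t => (derivative^[j] q).eval t) (𝓝[<] b)
      (𝓝 ((derivative^[j] q).eval b)) :=
    ((derivative^[j] q).continuous.tendsto b).mono_left nhdsWithin_le_nhds
  refine hc.congr' ?_
  filter_upwards [Ioo_mem_nhdsLT hab] with t ht
  have h2 := Set.EqOn.iteratedDeriv_of_isOpen (f := f) (g := fun t => q.eval t)
    (s := Set.Ioo a b) h isOpen_Ioo j ht
  rw [h2, iteratedDeriv_polynomial_eval]

theorem exists_index_Ico {x : ℤ → ℝ} (hx : StrictMono x) (h1 : Tendsto x atTop atTop)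
    (h2 : Tendsto x atBot atBot) (t : ℝ) : ∃ i, x (i - 1) ≤ t ∧ t < x i := by
  obtain ⟨b, hb⟩ := (h1.eventually_gt_atTop t).exists
  obtain ⟨a, ha⟩ := (h2.eventually_le_atBot t).exists
  obtain ⟨m, hm, hm'⟩ := Int.exists_greatest_of_bdd (P := fun i => x i ≤ t)
    ⟨b, fun z hz => (hx.lt_iff_lt.1 (lt_of_le_of_lt hz hb)).le⟩ ⟨a, ha⟩
  refine ⟨m + 1, by simpa using hm, ?_⟩
  by_contra! hcon
  have := hm' _ hcon
  omega

theorem exists_index_Ioc {x : ℤ → ℝ} (hx : StrictMono x) (h1 : Tendsto x atTop atTop)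
    (h2 : Tendsto x atBot atBot) (t : ℝ) : ∃ i, x (i - 1) < t ∧ t ≤ x i := by
  obtain ⟨i, hi, hi'⟩ := exists_index_Ico hx h1 h2 t
  rcases hi.lt_or_eq with h | h
  · exact ⟨i, h, hi'.le⟩
  · exact ⟨i - 1, by rw [← h]; exact hx (by omega), h.ge⟩

/-- The truncated power `(r - |z|)₊ ^ j`. -/
noncomputable def truncPow (j : ℕ) (r z : ℝ) : ℝ := (max (r - |z|) 0) ^ j

/-- The `j`-th Taylor coefficient at `0⁺` of the odd part `f(t) - f(-t)`. -/
noncomputable def oddCoeff (f : ℝ → ℝ) (j : ℕ) : ℝ :=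
  (rightLim (iteratedDeriv j f) 0 - rightLim (iteratedDeriv j (fun t => f (-t))) 0) /
    (j.factorial : ℝ)

/-- The Heaviside function with value `1 / 2` at the origin. -/
noncomputable def heaviside (z : ℝ) : ℝ := if 0 < z then 1 else if z = 0 then 1 / 2 else 0

theorem heaviside_add_neg (z : ℝ) : heaviside z + heaviside (-z) = 1 := by
  unfold heaviside
  rcases lt_trichotomy z 0 with h | h | h
  · simp [h, h.ne, not_lt.2 h.le]
  · subst h; norm_num
  · simp [h, not_lt.2 h.le, h.ne']

theorem heaviside_nonneg (z : ℝ) : 0 ≤ heaviside z := by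
  unfold heaviside; split_ifs <;> norm_num

theorem heaviside_le_one (z : ℝ) : heaviside z ≤ 1 := by
  unfold heaviside; split_ifs <;> norm_num

theorem truncPow_zero_right (j : ℕ) {t : ℝ} (ht : 0 ≤ t) : truncPow j t 0 = t ^ j := by
  simp [truncPow, ht]

theorem truncPow_eq_zero {j : ℕ} (hj : 1 ≤ j) {t z : ℝ} (h : t ≤ |z|) : truncPow j t z = 0 := by
  unfold truncPow
  rw [max_eq_right (by linarith), zero_pow (by omega)]

theorem truncPow_nonneg (j : ℕ) (t z : ℝ) : 0 ≤ truncPow j t z := by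
  unfold truncPow; positivity

theorem sum_range_succ_eq_Icc (n : ℕ) (g : ℕ → ℝ) :
    ∑ j ∈ Finset.range (n + 1), g j = g 0 + ∑ j ∈ Finset.Icc 1 n, g j := by
  rw [Finset.range_eq_Ico, Finset.sum_eq_sum_Ico_succ_bot (by omega)]
  rfl

theorem eval_eq_taylor_sum {n : ℕ} {q : ℝ[X]} (hq : q.natDegree ≤ n) (z t : ℝ) :
    q.eval t = q.eval z + ∑ j ∈ Finset.Icc 1 n, (taylor z q).coeff j * (t - z) ^ j := by
  have h1 : q.eval t = (taylor z q).eval (t - z) := by rw [taylor_eval]; ring_nf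
  rw [h1, eval_eq_sum_range' (n := n + 1) (by rw [natDegree_taylor]; omega),
    sum_range_succ_eq_Icc]
  simp

theorem oddCoeff_comp_neg (f : ℝ → ℝ) (j : ℕ) : oddCoeff (fun t => f (-t)) j = -oddCoeff f j := by
  unfold oddCoeff
  simp only [neg_neg]
  ring

/-! ### Reflection, jumps and the Poisson–Jensen representation. -/

namespace IsPiecewisePolynomial

variable {n : ℕ} {f : ℝ → ℝ} {x : ℤ → ℝ} {p : ℤ → ℝ[X]}

/-- Reflection transfers every statement about the positive half-line to the negative one. -/
theorem comp_neg (h : IsPiecewisePolynomial n f x p) :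
    IsPiecewisePolynomial n (fun t => f (-t)) (fun i => -x (-i))
      (fun i => (p (1 - i)).comp (-X)) where
  strictMono := fun i j hij => neg_lt_neg (h.strictMono (neg_lt_neg hij))
  tendsto_atTop := tendsto_neg_atBot_atTop.comp (h.tendsto_atBot.comp tendsto_neg_atTop_atBot)
  tendsto_atBot := tendsto_neg_atTop_atBot.comp (h.tendsto_atTop.comp tendsto_neg_atBot_atTop)
  continuous := h.continuous.comp continuous_neg
  eqOn := by
    intro i t ht
    have := h.eqOn (1 - i) (-t) ⟨?_, ?_⟩
    · simpa [eval_comp] using this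
    · have := ht.2
      rw [show 1 - i - 1 = -i by ring]; linarith
    · have := ht.1
      rw [show 1 - i = -(i - 1) by ring]; linarith
  natDegree_le := by
    intro i
    simpa [natDegree_comp] using h.natDegree_le (1 - i)
  exists_natDegree_eq := by
    obtain ⟨i, hi⟩ := h.exists_natDegree_eq
    exact ⟨1 - i, by simpa [natDegree_comp] using hi⟩

theorem rightLim_eq (h : IsPiecewisePolynomial n f x p) {i : ℤ} {z : ℝ} (h1 : x (i - 1) ≤ z)
    (h2 : z < x i) (j : ℕ) :
    rightLim (iteratedDeriv j f) z = (j.factorial : ℝ) * (taylor z (p i)).coeff j :=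
  rightLim_iteratedDeriv h2 (fun t ht => h.eqOn i t ⟨h1.trans ht.1.le, ht.2.le⟩) j

theorem leftLim_eq (h : IsPiecewisePolynomial n f x p) {i : ℤ} {z : ℝ} (h1 : x (i - 1) < z)
    (h2 : z ≤ x i) (j : ℕ) :
    leftLim (iteratedDeriv j f) z = (j.factorial : ℝ) * (taylor z (p i)).coeff j :=
  leftLim_iteratedDeriv h1 (fun t ht => h.eqOn i t ⟨ht.1.le, ht.2.le.trans h2⟩) j

theorem rightLim_comp_neg (h : IsPiecewisePolynomial n f x p) (j : ℕ) (z : ℝ) :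
    rightLim (iteratedDeriv j (fun t => f (-t))) z
      = (-1) ^ j * leftLim (iteratedDeriv j f) (-z) := by
  obtain ⟨i, h1, h2⟩ := exists_index_Ioc h.strictMono h.tendsto_atTop h.tendsto_atBot (-z)
  have hl : Tendsto (iteratedDeriv j f) (𝓝[<] (-z)) (𝓝 (leftLim (iteratedDeriv j f) (-z))) := by
    rw [h.leftLim_eq h1 h2, ← iterate_derivative_eval_eq_taylor_coeff]
    refine (((derivative^[j] (p i)).continuous.tendsto (-z)).mono_left
      nhdsWithin_le_nhds).congr' ?_
    filter_upwards [Ioo_mem_nhdsLT h1] with t ht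
    rw [Set.EqOn.iteratedDeriv_of_isOpen (f := f) (g := fun t => (p i).eval t)
      (s := Set.Ioo (x (i - 1)) (-z))
      (fun t ht => h.eqOn i t ⟨ht.1.le, ht.2.le.trans h2⟩) isOpen_Ioo j ht,
      iteratedDeriv_polynomial_eval]
  apply rightLim_eq_of_tendsto
  have hneg : Tendsto (fun t : ℝ => -t) (𝓝[>] z) (𝓝[<] (-z)) := by
    refine tendsto_nhdsWithin_iff.2 ⟨(continuous_neg.tendsto z).mono_left nhdsWithin_le_nhds, ?_⟩
    filter_upwards [self_mem_nhdsWithin] with t ht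
    exact Set.mem_Iio.2 (neg_lt_neg (Set.mem_Ioi.1 ht))
  refine ((hl.comp hneg).const_mul ((-1) ^ j)).congr fun t => ?_
  rw [iteratedDeriv_comp_neg]
  simp

theorem leftLim_comp_neg (h : IsPiecewisePolynomial n f x p) (j : ℕ) (z : ℝ) :
    leftLim (iteratedDeriv j (fun t => f (-t))) z
      = (-1) ^ j * rightLim (iteratedDeriv j f) (-z) := by
  have := h.comp_neg.rightLim_comp_neg j (-z)
  simp only [neg_neg] at this
  rw [this, ← mul_assoc, ← mul_pow]
  simp

/-- Reflection swaps the one-sided limits with a factor `(-1) ^ j`, and the signs contribute `(-1) ^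
(j + 1)`; the product `-1` undoes the swap. This is the role of the power of `sgn` in `omega`. -/
theorem omega_comp_neg (h : IsPiecewisePolynomial n f x p) (j : ℕ) (z : ℝ) :
    omega (fun t => f (-t)) j z = omega f j (-z) := by
  unfold omega
  rw [h.rightLim_comp_neg, h.leftLim_comp_neg]
  have h1 : sgnRight (-z) = -sgnLeft z := by
    unfold sgnRight sgnLeft
    by_cases hz : 0 < z
    · simp [hz]
    · simp [hz, not_lt.1 hz]
  have h2 : sgnLeft (-z) = -sgnRight z := by
    unfold sgnRight sgnLeft
    by_cases hz : 0 ≤ z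
    · simp [hz]
    · simp [hz, not_le.1 hz]
  rw [h1, h2]
  have e : ∀ s : ℝ, (-s) ^ (j + 1) = -((-1) ^ j * s ^ (j + 1)) := by
    intro s; rw [neg_pow, pow_succ (-1 : ℝ)]; ring
  rw [e, e]
  ring

/-- At the origin `omega` is the sum, and `oddCoeff` the difference, of the `j`-th coefficients at
`0⁺` of `f t` and `f (-t)`. -/
theorem rightLim_zero_eq (h : IsPiecewisePolynomial n f x p) (j : ℕ) :
    rightLim (iteratedDeriv j f) 0 / (j.factorial : ℝ) = (omega f j 0 + oddCoeff f j) / 2 := by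
  have := h.rightLim_comp_neg j 0
  unfold omega oddCoeff
  rw [this]
  simp [sgnRight, sgnLeft, pow_succ]
  ring

theorem omega_of_pos (h : IsPiecewisePolynomial n f x p) {i k : ℤ} {z : ℝ} (hz : 0 < z)
    (h1 : x (i - 1) ≤ z) (h2 : z < x i) (h3 : x (k - 1) < z) (h4 : z ≤ x k) (j : ℕ) :
    omega f j z = (taylor z (p i - p k)).coeff j := by
  unfold omega
  rw [h.rightLim_eq h1 h2, h.leftLim_eq h3 h4]
  have : (j.factorial : ℝ) ≠ 0 := by positivity
  simp only [sgnRight, sgnLeft, hz, hz.le, if_true, one_pow, one_mul, map_sub, coeff_sub]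
  field_simp

theorem omega_breakpoint (h : IsPiecewisePolynomial n f x p) {i : ℤ} (hi : 0 < x i) (j : ℕ) :
    omega f j (x i) = (taylor (x i) (p (i + 1) - p i)).coeff j :=
  h.omega_of_pos hi (by simp) (h.strictMono (by omega)) (h.strictMono (by omega)) le_rfl j

theorem mem_range_of_omega_ne_zero_of_pos (h : IsPiecewisePolynomial n f x p) {j : ℕ} {z : ℝ}
    (hz : 0 < z) (hw : omega f j z ≠ 0) : z ∈ Set.range x := by
  by_contra hr
  obtain ⟨i, h1, h2⟩ := exists_index_Ico h.strictMono h.tendsto_atTop h.tendsto_atBot z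
  have h1' : x (i - 1) < z := lt_of_le_of_ne h1 fun e => hr ⟨_, e⟩
  apply hw
  rw [h.omega_of_pos hz h1 h2 h1' h2.le]
  simp

theorem finite_range_inter (h : IsPiecewisePolynomial n f x p) (M : ℝ) :
    (Set.range x ∩ Set.Icc (-M) M).Finite := by
  obtain ⟨b, hb⟩ := (h.tendsto_atTop.eventually_gt_atTop M).exists
  obtain ⟨a, ha⟩ := (h.tendsto_atBot.eventually_lt_atBot (-M)).exists
  refine ((Set.finite_Icc a b).image x).subset ?_
  rintro _ ⟨⟨i, rfl⟩, hi⟩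
  exact ⟨i, ⟨(h.strictMono.lt_iff_lt.1 (ha.trans_le hi.1)).le,
    (h.strictMono.lt_iff_lt.1 (hi.2.trans_lt hb)).le⟩, rfl⟩

/-- There is a finite set carrying all poles and roots in `(-M, M)`. -/
theorem exists_finset (h : IsPiecewisePolynomial n f x p) (M : ℝ) :
    ∃ S : Finset ℝ, 0 ∈ S ∧ ∀ j z, |z| < M → omega f j z ≠ 0 → z ∈ S := by
  have hfin := (((h.finite_range_inter M).union (h.comp_neg.finite_range_inter M).neg).union
    (Set.finite_singleton (0 : ℝ)))
  refine ⟨hfin.toFinset, by simp, fun j z hz hw => ?_⟩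
  rw [Set.Finite.mem_toFinset]
  have hz' := abs_lt.1 hz
  rcases lt_trichotomy z 0 with h0 | h0 | h0
  · refine Or.inl (Or.inr ⟨h.comp_neg.mem_range_of_omega_ne_zero_of_pos (j := j)
      (neg_pos.2 h0) ?_, ⟨by linarith, by linarith⟩⟩)
    rwa [h.omega_comp_neg, neg_neg]
  · exact Or.inr h0
  · exact Or.inl (Or.inl ⟨h.mem_range_of_omega_ne_zero_of_pos h0 hw, hz'.1.le, hz'.2.le⟩)

/-- Telescoping over the breakpoints in `(0, t)`. -/
theorem eq_sum_breakpoints (h : IsPiecewisePolynomial n f x p) {k m : ℤ} {t : ℝ}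
    (hk : x (k - 1) ≤ 0) (hk' : 0 < x k) (hm : x (m - 1) ≤ t) (hm' : t ≤ x m) (hkm : k ≤ m) :
    f t = f 0 + ∑ j ∈ Finset.Icc 1 n, (rightLim (iteratedDeriv j f) 0 / (j.factorial : ℝ) * t ^ j
      + ∑ i ∈ Finset.Ico k m, omega f j (x i) * (t - x i) ^ j) := by
  have htel : ∀ l, k ≤ l → p l = p k + ∑ i ∈ Finset.Ico k l, (p (i + 1) - p i) := by
    intro l hl
    induction l, hl using Int.leInduction with
    | base => simp
    | succ l hl ih =>
      have : Finset.Ico k (l + 1) = insert l (Finset.Ico k l) := by ext; simp; omega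
      rw [this, Finset.sum_insert (by simp)]
      linear_combination ih
  have hterm : ∀ i ∈ Finset.Ico k m, (p (i + 1) - p i).eval t
      = ∑ j ∈ Finset.Icc 1 n, omega f j (x i) * (t - x i) ^ j := by
    intro i hi
    have hxi : 0 < x i := hk'.trans_le (h.strictMono.monotone (Finset.mem_Ico.1 hi).1)
    -- Continuity at the breakpoint removes the constant term of the jump polynomial, so only orders
    -- `j ≥ 1` remain.
    have e0 : (p (i + 1) - p i).eval (x i) = 0 := by
      rw [eval_sub, ← h.eqOn (i + 1) (x i) ⟨by simp, (h.strictMono (by omega)).le⟩,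
        ← h.eqOn i (x i) ⟨(h.strictMono (by omega)).le, le_rfl⟩, sub_self]
    rw [eval_eq_taylor_sum (n := n) ((natDegree_sub_le _ _).trans
      (max_le (h.natDegree_le _) (h.natDegree_le _))) (x i) t, e0, zero_add]
    exact Finset.sum_congr rfl fun j _ => by rw [h.omega_breakpoint hxi]
  rw [h.eqOn m t ⟨hm, hm'⟩, htel m hkm, eval_add, eval_finsetSum, Finset.sum_congr rfl hterm,
    Finset.sum_comm, Finset.sum_add_distrib, eval_eq_taylor_sum (h.natDegree_le k) 0 t,
    ← h.eqOn k 0 ⟨hk, hk'.le⟩, add_assoc]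
  congr 2
  refine Finset.sum_congr rfl fun j _ => ?_
  rw [h.rightLim_eq hk hk']
  have : (j.factorial : ℝ) ≠ 0 := by positivity
  field_simp
  simp

/-- Poisson–Jensen representation at a nonnegative point. -/
theorem representation (h : IsPiecewisePolynomial n f x p) {t : ℝ} (ht : 0 ≤ t) {S : Finset ℝ}
    (h0 : 0 ∈ S) (hS : ∀ j z, |z| < t → omega f j z ≠ 0 → z ∈ S) :
    f t = f 0 + ∑ j ∈ Finset.Icc 1 n, (oddCoeff f j / 2 * truncPow j t 0 +
      ∑ z ∈ S, heaviside z * omega f j z * truncPow j t z) := by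
  obtain ⟨k, hk, hk'⟩ := exists_index_Ico h.strictMono h.tendsto_atTop h.tendsto_atBot 0
  obtain ⟨m, hm, hm'⟩ := exists_index_Ico h.strictMono h.tendsto_atTop h.tendsto_atBot t
  have hkm : k ≤ m := by
    have := h.strictMono.lt_iff_lt.1 (lt_of_le_of_lt (hk.trans ht) hm')
    omega
  rw [h.eq_sum_breakpoints hk hk' hm hm'.le hkm]
  congr 1
  refine Finset.sum_congr rfl fun j hj => ?_
  have hj1 := (Finset.mem_Icc.1 hj).1
  rw [h.rightLim_zero_eq, truncPow_zero_right j ht,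
    ← Finset.add_sum_erase S _ h0, truncPow_zero_right j ht]
  -- The point `0` is kept apart: its weight `1 / 2` joins `oddCoeff f j / 2` to form the
  -- coefficient at `0⁺`. The other two sums agree since extra terms have zero weight, zero jump or
  -- zero truncated power.
  have key : ∑ i ∈ Finset.Ico k m, omega f j (x i) * (t - x i) ^ j
      = ∑ z ∈ S.erase 0, heaviside z * omega f j z * truncPow j t z := by
    have hpos : ∀ i ∈ Finset.Ico k m, 0 < x i ∧ x i ≤ t := by
      intro i hi
      rw [Finset.mem_Ico] at hi
      exact ⟨hk'.trans_le (h.strictMono.monotone hi.1),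
        (h.strictMono.monotone (by omega)).trans hm⟩
    have e1 : ∑ i ∈ Finset.Ico k m, omega f j (x i) * (t - x i) ^ j
        = ∑ z ∈ (Finset.Ico k m).image x, heaviside z * omega f j z * truncPow j t z := by
      rw [Finset.sum_image h.strictMono.injective.injOn]
      refine Finset.sum_congr rfl fun i hi => ?_
      obtain ⟨a1, a2⟩ := hpos i hi
      rw [heaviside, if_pos a1, truncPow, abs_of_pos a1, max_eq_left (by linarith), one_mul]
    rw [e1]
    have z1 : ∀ z, z ∉ (Finset.Ico k m).image x → z ≠ 0 →
        heaviside z * omega f j z * truncPow j t z = 0 := by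
      intro z hz hz0
      by_cases hzp : 0 < z
      · by_cases hw : omega f j z = 0
        · simp [hw]
        by_cases htz : t ≤ |z|
        · rw [truncPow_eq_zero hj1 htz, mul_zero]
        exfalso
        rw [abs_of_pos hzp, not_le] at htz
        obtain ⟨i, rfl⟩ := h.mem_range_of_omega_ne_zero_of_pos hzp hw
        apply hz
        refine Finset.mem_image_of_mem _ (Finset.mem_Ico.2 ⟨?_, ?_⟩)
        · have := h.strictMono.lt_iff_lt.1 (lt_of_le_of_lt hk hzp); omega
        · exact h.strictMono.lt_iff_lt.1 (htz.trans hm')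
      · simp [heaviside, hzp, hz0]
    have z2 : ∀ z, z ∉ S.erase 0 → z ≠ 0 →
        heaviside z * omega f j z * truncPow j t z = 0 := by
      intro z hz hz0
      by_cases hw : omega f j z = 0
      · simp [hw]
      by_cases htz : t ≤ |z|
      · rw [truncPow_eq_zero hj1 htz, mul_zero]
      exact absurd (Finset.mem_erase.2 ⟨hz0, hS j z (not_le.1 htz) hw⟩) hz
    refine (Finset.sum_subset (Finset.subset_union_left (s₂ := S.erase 0)) ?_).trans
      (Finset.sum_subset Finset.subset_union_right ?_).symm
    · intro z hz hz'
      refine z1 z hz' ?_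
      rintro rfl
      rcases Finset.mem_union.1 hz with h1 | h1
      · exact hz' h1
      · simp at h1
    · intro z hz hz'
      refine z2 z hz' ?_
      rintro rfl
      rcases Finset.mem_union.1 hz with h1 | h1
      · obtain ⟨i, hi, e⟩ := Finset.mem_image.1 h1
        exact (hpos i hi).1.ne' e
      · exact hz' h1
  rw [key]
  simp only [heaviside, lt_irrefl, if_false, if_true]
  ring

theorem representation_neg (h : IsPiecewisePolynomial n f x p) {t : ℝ} (ht : 0 ≤ t)
    {S : Finset ℝ} (h0 : 0 ∈ S) (hS : ∀ j z, |z| < t → omega f j z ≠ 0 → z ∈ S) :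
    f (-t) = f 0 + ∑ j ∈ Finset.Icc 1 n, (-(oddCoeff f j) / 2 * truncPow j t 0 +
      ∑ z ∈ S, heaviside (-z) * omega f j z * truncPow j t z) := by
  have hinj : Set.InjOn (fun z : ℝ => -z) S := neg_injective.injOn
  have := h.comp_neg.representation ht (S := S.image (fun z => -z)) (by simpa using h0)
    (by
      intro j z hz hw
      rw [h.omega_comp_neg] at hw
      exact Finset.mem_image.2 ⟨-z, hS j (-z) (by simpa using hz) hw, neg_neg z⟩)
  simp only [neg_zero, oddCoeff_comp_neg] at this
  rw [this]
  congr 1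
  refine Finset.sum_congr rfl fun j _ => ?_
  rw [Finset.sum_image hinj]
  congr 1
  refine Finset.sum_congr rfl fun z _ => ?_
  rw [h.omega_comp_neg, neg_neg]
  simp [truncPow]

end IsPiecewisePolynomial

/-! ### Truncated powers and the majorant. -/

theorem truncPow_mono (j : ℕ) (z : ℝ) : Monotone fun r => truncPow j r z := by
  intro r r' h
  exact pow_le_pow_left₀ (le_max_right _ _) (max_le_max (by linarith) le_rfl) j

/-- By convexity of `u ^ j`, the slope up to `t - |z|` is at most the slope from there to `R - |z|`,
hence at most `(R - |z|) ^ j / (R - t)`; truncation only shortens the increment `t - s`. -/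
theorem truncPow_sub_le {j : ℕ} (hj : 1 ≤ j) {s t R : ℝ} (hst : s ≤ t) (htR : t < R) (z : ℝ) :
    truncPow j t z - truncPow j s z ≤ (t - s) / (R - t) * truncPow j R z := by
  have hR : 0 < R - t := by linarith
  have hrhs : 0 ≤ (t - s) / (R - t) * truncPow j R z :=
    mul_nonneg (div_nonneg (by linarith) hR.le) (truncPow_nonneg _ _ _)
  rcases le_or_gt t |z| with htz | htz
  · rw [truncPow_eq_zero hj htz]
    have := truncPow_nonneg j s z
    linarith
  unfold truncPow at *
  rw [max_eq_left (by linarith : 0 ≤ t - |z|)]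
  rw [max_eq_left (by linarith : 0 ≤ R - |z|)] at *
  set a := max (s - |z|) 0 with ha
  have ha0 : 0 ≤ a := le_max_right _ _
  have hab : a ≤ t - |z| := max_le (by linarith) (by linarith)
  have has : s - |z| ≤ a := le_max_left _ _
  rcases hab.eq_or_lt with he | hlt
  · rw [← he, sub_self]; exact hrhs
  have hd : 0 ≤ R - |z| := by linarith
  have := (convexOn_pow (𝕜 := ℝ) j).slope_mono_adjacent (x := a) (y := t - |z|) (z := R - |z|)
    ha0 hd hlt (by linarith)
  rw [div_le_iff₀ (by linarith)] at this
  have e : R - |z| - (t - |z|) = R - t := by ring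
  rw [e] at this
  calc (t - |z|) ^ j - a ^ j
      ≤ ((R - |z|) ^ j - (t - |z|) ^ j) / (R - t) * (t - |z| - a) := this
    _ ≤ (R - |z|) ^ j / (R - t) * (t - s) := by
        refine mul_le_mul ?_ (by linarith) (by linarith) (by positivity)
        gcongr
        have : 0 ≤ (t - |z|) ^ j := pow_nonneg (by linarith) _
        linarith
    _ = _ := by ring

/-- A monotone function comparable to the characteristic function. -/
noncomputable def majorant (n : ℕ) (f : ℝ → ℝ) (r : ℝ) : ℝ :=
  ∑ j ∈ Finset.Icc 1 n, (|oddCoeff f j| * truncPow j r 0 +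
    ∑ᶠ z, |omega f j z| * truncPow j r z)

theorem finsum_mul_truncPow {f : ℝ → ℝ} {j : ℕ} (hj : 1 ≤ j) {t : ℝ} {S : Finset ℝ}
    (hS : ∀ j z, |z| < t → omega f j z ≠ 0 → z ∈ S) {u : ℝ → ℝ}
    (hu : ∀ z, omega f j z = 0 → u z = 0) :
    ∑ᶠ z, u z * truncPow j t z = ∑ z ∈ S, u z * truncPow j t z := by
  refine finsum_eq_sum_of_support_subset _ fun z hz => ?_
  rw [Function.mem_support] at hz
  refine hS j z ?_ ?_
  · by_contra! hc
    exact hz (by rw [truncPow_eq_zero hj hc, mul_zero])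
  · intro hw
    exact hz (by rw [hu z hw, zero_mul])

theorem majorant_eq {n : ℕ} {f : ℝ → ℝ} {t : ℝ} {S : Finset ℝ}
    (hS : ∀ j z, |z| < t → omega f j z ≠ 0 → z ∈ S) :
    majorant n f t = ∑ j ∈ Finset.Icc 1 n, (|oddCoeff f j| * truncPow j t 0 +
      ∑ z ∈ S, |omega f j z| * truncPow j t z) := by
  refine Finset.sum_congr rfl fun j hj => ?_
  rw [finsum_mul_truncPow (Finset.mem_Icc.1 hj).1 hS]
  intro z hz
  simp [hz]

theorem counting_eq {f : ℝ → ℝ} {j : ℕ} (hj : 1 ≤ j) {t : ℝ} {S : Finset ℝ}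
    (hS : ∀ j z, |z| < t → omega f j z ≠ 0 → z ∈ S) :
    counting j t f = 1 / 2 * ∑ z ∈ S, max (-omega f j z) 0 * truncPow j t z := by
  unfold counting
  rw [← finsum_mul_truncPow hj hS (by intro z hz; simp [hz]), finsum_mem_def]
  congr 2
  funext z
  by_cases hz : z ∈ poles f j ∩ Set.Ioo (-t) t
  · rw [Set.indicator_of_mem hz]
    have h1 : omega f j z < 0 := hz.1
    have h2 : |z| < t := abs_lt.2 hz.2
    rw [truncPow, abs_of_neg h1, max_eq_left (by linarith), max_eq_left (by linarith)]
  · rw [Set.indicator_of_notMem hz]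
    symm
    by_cases h1 : omega f j z < 0
    · rw [truncPow_eq_zero hj, mul_zero]
      by_contra! hc
      exact hz ⟨h1, abs_lt.1 hc⟩
    · rw [max_eq_right (by linarith), zero_mul]

theorem majorant_nonneg (n : ℕ) (f : ℝ → ℝ) (r : ℝ) : 0 ≤ majorant n f r :=
  Finset.sum_nonneg fun _ _ => add_nonneg (mul_nonneg (abs_nonneg _) (truncPow_nonneg _ _ _))
    (finsum_nonneg fun _ => mul_nonneg (abs_nonneg _) (truncPow_nonneg _ _ _))

/-- Taking absolute values of coefficients preserves the degree, and polynomials of equal degree are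
comparable at infinity. -/
theorem exists_sum_abs_le (k : ℕ → ℝ) (n : ℕ) : ∃ K, 0 ≤ K ∧ ∀ᶠ r : ℝ in atTop,
    ∑ j ∈ Finset.Icc 1 n, |k j| * r ^ j ≤ K * |∑ j ∈ Finset.Icc 1 n, k j * r ^ j| := by
  have hdeg : (∑ j ∈ Finset.Icc 1 n, C |k j| * X ^ j : ℝ[X]).degree
      ≤ (∑ j ∈ Finset.Icc 1 n, C (k j) * X ^ j : ℝ[X]).degree := by
    refine degree_mono fun i hi => ?_
    rw [mem_support_iff] at hi ⊢
    simp only [finsetSum_coeff, coeff_C_mul, coeff_X_pow, mul_ite, mul_one, mul_zero,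
      Finset.sum_ite_eq] at hi ⊢
    split_ifs at hi ⊢ with h1
    · simpa using hi
    · exact hi
  obtain ⟨K, hK, hb⟩ := (isBigO_atTop_of_degree_le _ _ hdeg).exists_nonneg
  refine ⟨K, hK, ?_⟩
  filter_upwards [hb.bound] with r hr
  simp only [eval_finsetSum, eval_mul, eval_C, eval_pow, eval_X, Real.norm_eq_abs] at hr
  exact (le_abs_self _).trans hr

theorem proximity_nonneg (r : ℝ) (f : ℝ → ℝ) : 0 ≤ proximity r f := by
  unfold proximity; positivity

/-! ### Increments, growth of the majorant and comparison with the characteristic function. -/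

namespace IsPiecewisePolynomial

variable {n : ℕ} {f : ℝ → ℝ} {x : ℤ → ℝ} {p : ℤ → ℝ[X]}

theorem majorant_mono (h : IsPiecewisePolynomial n f x p) : Monotone (majorant n f) := by
  intro r r' hr
  obtain ⟨S, -, hS⟩ := h.exists_finset r'
  rw [majorant_eq hS, majorant_eq fun j z hz => hS j z (hz.trans_le hr)]
  gcongr
  · exact truncPow_mono _ 0 hr
  · exact truncPow_mono _ _ hr

theorem majorant_comp_neg (h : IsPiecewisePolynomial n f x p) :
    majorant n (fun t => f (-t)) = majorant n f := by
  funext r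
  unfold majorant
  refine Finset.sum_congr rfl fun j _ => ?_
  rw [oddCoeff_comp_neg, abs_neg]
  congr 1
  simp only [h.omega_comp_neg]
  rw [← finsum_comp_equiv (Equiv.neg ℝ)]
  simp [truncPow]

/-- Increments of `f` are controlled by the majorant. -/
theorem abs_sub_le (h : IsPiecewisePolynomial n f x p) {s t R : ℝ} (hs : 0 ≤ s) (hst : s ≤ t)
    (htR : t < R) : |f t - f s| ≤ (t - s) / (R - t) * majorant n f R := by
  obtain ⟨S, h0, hS⟩ := h.exists_finset R
  rw [h.representation hs h0 fun j z hz => hS j z (by linarith),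
    h.representation (hs.trans hst) h0 fun j z hz => hS j z (by linarith), majorant_eq hS,
    add_sub_add_left_eq_sub, ← Finset.sum_sub_distrib, Finset.mul_sum]
  refine (Finset.abs_sum_le_sum_abs _ _).trans (Finset.sum_le_sum fun j hj => ?_)
  have hj1 := (Finset.mem_Icc.1 hj).1
  have hd : ∀ z, |truncPow j t z - truncPow j s z| ≤ (t - s) / (R - t) * truncPow j R z := by
    intro z
    rw [abs_of_nonneg (sub_nonneg.2 (truncPow_mono j z hst))]
    exact truncPow_sub_le hj1 hst htR z
  have hb : ∀ a b z, |a| ≤ b →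
      |a * (truncPow j t z - truncPow j s z)| ≤ (t - s) / (R - t) * (b * truncPow j R z) := by
    intro a b z hab
    rw [abs_mul]
    calc |a| * _ ≤ b * ((t - s) / (R - t) * truncPow j R z) :=
          mul_le_mul hab (hd z) (abs_nonneg _) ((abs_nonneg _).trans hab)
      _ = _ := by ring
  rw [add_sub_add_comm, ← mul_sub, ← Finset.sum_sub_distrib, mul_add, Finset.mul_sum]
  refine (abs_add_le _ _).trans (add_le_add (hb _ _ _ ?_) ?_)
  · rw [abs_div, abs_two]
    linarith [abs_nonneg (oddCoeff f j)]
  · refine (Finset.abs_sum_le_sum_abs _ _).trans (Finset.sum_le_sum fun z _ => ?_)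
    rw [← mul_sub]
    refine hb _ _ _ ?_
    rw [abs_mul, abs_of_nonneg (heaviside_nonneg z)]
    exact mul_le_of_le_one_left (abs_nonneg _) (heaviside_le_one z)

/-- Otherwise both representations reduce to `f 0`, so `f` is constant, contradicting a piece of
degree `n ≥ 1`. -/
theorem exists_coeff_ne_zero (h : IsPiecewisePolynomial n f x p) (hn : 1 ≤ n) :
    ∃ j ∈ Finset.Icc 1 n, oddCoeff f j ≠ 0 ∨ ∃ z, omega f j z ≠ 0 := by
  by_contra! hcon
  have h1 : ∀ t, 0 ≤ t → f t = f 0 ∧ f (-t) = f 0 := by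
    intro t ht
    obtain ⟨S, h0, hS⟩ := h.exists_finset t
    rw [h.representation ht h0 hS, h.representation_neg ht h0 hS]
    constructor <;>
    · rw [Finset.sum_eq_zero, add_zero]
      intro j hj
      obtain ⟨e1, e2⟩ := hcon j hj
      simp [e1, e2]
  have hconst : ∀ t, f t = f 0 := by
    intro t
    rcases le_total 0 t with ht | ht
    · exact (h1 t ht).1
    · simpa using (h1 (-t) (by linarith)).2
  obtain ⟨i, hi⟩ := h.exists_natDegree_eq
  have hlt : x (i - 1) < x i := h.strictMono (by omega)
  have : p i = C (f 0) := by
    refine Polynomial.eq_of_infinite_eval_eq _ _ ((Set.Icc_infinite hlt).mono fun t ht => ?_)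
    simp [← h.eqOn i t ht, hconst t]
  rw [this, natDegree_C] at hi
  omega

theorem tendsto_majorant (h : IsPiecewisePolynomial n f x p) (hn : 1 ≤ n) :
    Tendsto (majorant n f) atTop atTop := by
  obtain ⟨j, hj, hcoef⟩ := h.exists_coeff_ne_zero hn
  have hj1 := (Finset.mem_Icc.1 hj).1
  have htr : ∀ z a, 0 < a → Tendsto (fun r => a * truncPow j r z) atTop atTop := by
    intro z a ha
    refine Tendsto.const_mul_atTop ha ((tendsto_pow_atTop (by omega)).comp ?_)
    exact tendsto_atTop_mono (fun r => le_max_left _ _) (tendsto_atTop_add_const_right _ _ tendsto_id)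
  have hle : ∀ r, |oddCoeff f j| * truncPow j r 0 + ∑ᶠ z, |omega f j z| * truncPow j r z
      ≤ majorant n f r := fun r =>
    Finset.single_le_sum (f := fun j => |oddCoeff f j| * truncPow j r 0 +
      ∑ᶠ z, |omega f j z| * truncPow j r z) (fun j _ => add_nonneg
      (mul_nonneg (abs_nonneg _) (truncPow_nonneg _ _ _))
      (finsum_nonneg fun z => mul_nonneg (abs_nonneg _) (truncPow_nonneg _ _ _))) hj
  rcases hcoef with hk | ⟨z, hz⟩
  · refine tendsto_atTop_mono (fun r => ?_) (htr 0 _ (abs_pos.2 hk))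
    refine le_trans ?_ (hle r)
    exact le_add_of_nonneg_right
      (finsum_nonneg fun z => mul_nonneg (abs_nonneg _) (truncPow_nonneg _ _ _))
  · refine tendsto_atTop_mono (fun r => ?_) (htr z _ (abs_pos.2 hz))
    refine le_trans ?_ (hle r)
    -- The enlarged radius forces `z ∈ S` for every `r`, including `r ≤ |z|`.
    obtain ⟨S, h0, hS⟩ := h.exists_finset (max r (|z| + 1))
    rw [finsum_mul_truncPow hj1 (fun j z hz => hS j z (lt_max_of_lt_left hz))
      (fun z hz => by simp [hz])]
    have hzS : z ∈ S := hS j z (lt_max_of_lt_right (by linarith)) hz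
    have := Finset.single_le_sum (f := fun z => |omega f j z| * truncPow j r z)
      (fun z _ => mul_nonneg (abs_nonneg _) (truncPow_nonneg _ _ _)) hzS
    have h2 := mul_nonneg (abs_nonneg (oddCoeff f j)) (truncPow_nonneg j r 0)
    linarith

theorem counting_nonneg (h : IsPiecewisePolynomial n f x p) {j : ℕ} (hj : 1 ≤ j) (r : ℝ) :
    0 ≤ counting j r f := by
  obtain ⟨S, -, hS⟩ := h.exists_finset r
  rw [counting_eq hj hS]
  have := Finset.sum_nonneg fun z (_ : z ∈ S) =>
    mul_nonneg (le_max_right (-omega f j z) 0) (truncPow_nonneg j r z)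
  linarith

theorem majorant_le (h : IsPiecewisePolynomial n f x p) : ∃ K, 0 ≤ K ∧ ∀ᶠ r : ℝ in atTop,
    majorant n f r ≤ K * (16 * characteristic n r f + 6 * |f 0|)
      + (4 * characteristic n r f + 2 * |f 0|) := by
  obtain ⟨K, hK, hev⟩ := exists_sum_abs_le (oddCoeff f) n
  refine ⟨K, hK, ?_⟩
  filter_upwards [hev, eventually_ge_atTop 0] with r hr hr0
  obtain ⟨S, h0, hS⟩ := h.exists_finset r
  have e1 := h.representation hr0 h0 hS
  have e2 := h.representation_neg hr0 h0 hS
  set G := ∑ j ∈ Finset.Icc 1 n, ∑ z ∈ S, |omega f j z| * truncPow j r z with hG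
  set N := ∑ j ∈ Finset.Icc 1 n, counting j r f with hN
  have hG0 : 0 ≤ G := Finset.sum_nonneg fun j _ => Finset.sum_nonneg fun z _ =>
    mul_nonneg (abs_nonneg _) (truncPow_nonneg _ _ _)
  have hN0 : 0 ≤ N := Finset.sum_nonneg fun j hj => h.counting_nonneg (Finset.mem_Icc.1 hj).1 r
  have hT : characteristic n r f = proximity r f + N := rfl
  have hm0 := proximity_nonneg r f
  have hm : proximity r f = (max (f r) 0 + max (f (-r)) 0) / 2 := rfl
  -- Jensen's formula: the odd parts cancel, the two Heaviside weights add to `1`, and `ω = |ω| -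
  -- 2ω⁻`, where `ω⁻` is what `counting` sums with factor `1 / 2`.
  have hjensen : f r + f (-r) = 2 * f 0 + G - 4 * N := by
    rw [e1, e2, hG, hN, Finset.mul_sum]
    have : ∀ A B : ℝ, f 0 + A + (f 0 + B) = 2 * f 0 + (A + B) := fun A B => by ring
    rw [this, add_sub_assoc, ← Finset.sum_add_distrib, ← Finset.sum_sub_distrib]
    congr 1
    refine Finset.sum_congr rfl fun j hj => ?_
    rw [counting_eq (Finset.mem_Icc.1 hj).1 hS]
    have : ∀ a b c d : ℝ, a / 2 * b + c + (-a / 2 * b + d) = c + d := fun a b c d => by ring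
    rw [this, ← mul_assoc, Finset.mul_sum, ← Finset.sum_add_distrib, ← Finset.sum_sub_distrib]
    refine Finset.sum_congr rfl fun z _ => ?_
    have hw : omega f j z = |omega f j z| - 2 * max (-omega f j z) 0 := by
      rcases le_total 0 (omega f j z) with hw | hw
      · rw [abs_of_nonneg hw, max_eq_right (by linarith)]; ring
      · rw [abs_of_nonpos hw, max_eq_left (by linarith)]; ring
    have he := heaviside_add_neg z
    linear_combination (omega f j z * truncPow j r z) * he + truncPow j r z * hw
  -- In `f r - f (-r)` the odd polynomial survives, and the jumps carry weights of modulus at most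
  -- `1`.
  have hQ : |∑ j ∈ Finset.Icc 1 n, oddCoeff f j * r ^ j| ≤ |f r| + |f (-r)| + G := by
    have : ∑ j ∈ Finset.Icc 1 n, oddCoeff f j * r ^ j = f r - f (-r) -
        ∑ j ∈ Finset.Icc 1 n, ∑ z ∈ S, (heaviside z - heaviside (-z)) * omega f j z
          * truncPow j r z := by
      rw [e1, e2, add_sub_add_left_eq_sub, ← Finset.sum_sub_distrib, ← Finset.sum_sub_distrib]
      refine Finset.sum_congr rfl fun j _ => ?_
      rw [truncPow_zero_right j hr0]
      simp only [sub_mul, Finset.sum_sub_distrib]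
      ring
    rw [this]
    refine (abs_sub _ _).trans (add_le_add (abs_sub _ _) ?_)
    refine (Finset.abs_sum_le_sum_abs _ _).trans (Finset.sum_le_sum fun j _ => ?_)
    refine (Finset.abs_sum_le_sum_abs _ _).trans (Finset.sum_le_sum fun z _ => ?_)
    rw [abs_mul, abs_mul, abs_of_nonneg (truncPow_nonneg j r z)]
    refine mul_le_mul_of_nonneg_right (mul_le_of_le_one_left (abs_nonneg _) ?_)
      (truncPow_nonneg j r z)
    rw [abs_le]
    constructor <;> linarith [heaviside_add_neg z, heaviside_nonneg z, heaviside_nonneg (-z)]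
  have m1 := le_max_left (f r) 0
  have m2 := le_max_right (f r) 0
  have m3 := le_max_left (f (-r)) 0
  have m4 := le_max_right (f (-r)) 0
  have f0 := neg_abs_le (f 0)
  have f0' := abs_nonneg (f 0)
  have hfr : |f r| ≤ 6 * characteristic n r f + 2 * |f 0| := by
    rw [abs_le]; constructor <;> linarith
  have hfr' : |f (-r)| ≤ 6 * characteristic n r f + 2 * |f 0| := by
    rw [abs_le]; constructor <;> linarith
  have hGT : G ≤ 4 * characteristic n r f + 2 * |f 0| := by linarith
  have hmaj : majorant n f r = ∑ j ∈ Finset.Icc 1 n, |oddCoeff f j| * r ^ j + G := by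
    rw [majorant_eq hS, Finset.sum_add_distrib]
    simp only [truncPow_zero_right _ hr0]
    rfl
  rw [hmaj]
  refine add_le_add (hr.trans (mul_le_mul_of_nonneg_left ?_ hK)) hGT
  linarith

/-- The majorant is dominated by the characteristic function. -/
theorem exists_majorant_le_mul (h : IsPiecewisePolynomial n f x p) (hn : 1 ≤ n) :
    ∃ K, 0 < K ∧ ∀ᶠ r : ℝ in atTop, majorant n f r ≤ K * characteristic n r f := by
  obtain ⟨K, hK, hev⟩ := h.majorant_le
  -- The constant `(6 * K + 2) * |f 0|` is eventually at most half of the majorant and is absorbed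
  -- on the left.
  refine ⟨2 * (16 * K + 4), by positivity, ?_⟩
  filter_upwards [hev, (h.tendsto_majorant hn).eventually_ge_atTop
    (2 * ((6 * K + 2) * |f 0|))] with r h1 h2
  linarith

end IsPiecewisePolynomial

/-! ### A Borel-type growth lemma. -/

theorem lintegral_one_div_Icc_le {a d : ℝ} (ha : 0 < a) (hda : d ≤ a / 2) :
    ∫⁻ r in Set.Icc (a - d) (a + d) ∩ Set.Ici 1, ENNReal.ofReal (1 / r)
      ≤ ENNReal.ofReal (4 * (d / a)) := by
  have hm : MeasurableSet (Set.Icc (a - d) (a + d) ∩ Set.Ici 1) :=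
    measurableSet_Icc.inter measurableSet_Ici
  calc ∫⁻ r in Set.Icc (a - d) (a + d) ∩ Set.Ici 1, ENNReal.ofReal (1 / r)
      ≤ ∫⁻ r in Set.Icc (a - d) (a + d) ∩ Set.Ici 1, ENNReal.ofReal (2 / a) := by
        refine setLIntegral_mono' hm fun r hr => ENNReal.ofReal_le_ofReal ?_
        have h1 : a / 2 ≤ r := by linarith [hr.1.1]
        rw [div_le_div_iff₀ (by linarith) ha]
        linarith
    _ = ENNReal.ofReal (2 / a) * volume (Set.Icc (a - d) (a + d) ∩ Set.Ici 1) := by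
        rw [setLIntegral_const]
    _ ≤ ENNReal.ofReal (2 / a) * ENNReal.ofReal (2 * d) := by
        gcongr
        refine (measure_mono Set.inter_subset_left).trans ?_
        rw [Real.volume_Icc]
        exact ENNReal.ofReal_le_ofReal (by linarith)
    _ = ENNReal.ofReal (4 * (d / a)) := by
        rw [← ENNReal.ofReal_mul (by positivity)]
        congr 1
        field_simp
        ring

/-- Borel-type growth lemma: a monotone function of growth `exp (r ^ τ)` at most doubles on
`[r, r + r ^ s]` outside a set of finite logarithmic measure, provided that `s + τ < 1`. -/
theorem exists_finite_log_measure_growth {S : ℝ → ℝ} (hmono : Monotone S)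
    (htop : Tendsto S atTop atTop) {C τ s : ℝ} (hC : 1 ≤ C) (hτ : 0 < τ) (hs0 : 0 ≤ s)
    (hsτ : s + τ < 1)
    (hbound : ∀ᶠ r in atTop, S r ≤ C * Real.exp (r ^ τ)) :
    ∃ E, HasFiniteLogMeasure E ∧ ∀ᶠ r in atTop, r ∉ E → S (r + r ^ s) ≤ 2 * S r := by
  have hs1 : s < 1 := by linarith
  have hsmall : ∀ᶠ r : ℝ in atTop, r ^ s ≤ r / 2 := by
    filter_upwards [(tendsto_rpow_atTop (sub_pos.2 hs1)).eventually_ge_atTop 2,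
      eventually_gt_atTop 0] with r hr hr0
    have h1 : r ^ s * r ^ (1 - s) = r := by
      rw [← Real.rpow_add hr0, add_sub_cancel, Real.rpow_one]
    nlinarith [Real.rpow_pos_of_pos hr0 s]
  obtain ⟨r₁, hr₁⟩ := eventually_atTop.1
    ((hbound.and hsmall).and ((htop.eventually_ge_atTop 1).and (eventually_ge_atTop 1)))
  set p := (1 - s) / τ with hp
  have hp1 : 1 < p := by rw [hp, lt_div_iff₀ hτ]; linarith
  have hl2 : 0 < Real.log 2 := Real.log_pos (by norm_num)
  have hlC : 0 ≤ Real.log C := Real.log_nonneg hC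
  -- Chosen so that `2 ^ k ≤ C * exp (a ^ τ)` and `1 ≤ a ^ τ` give `(k + 1) / D ≤ a ^ τ`.
  set D := (Real.log C + 1) / Real.log 2 + 1 with hD
  have hD0 : 0 < D := by positivity
  -- Two exceptional points in one dyadic level of `S` are close: passing `a + a ^ s` would more
  -- than double `S` and leave the level. So one exceptional `a` confines its level to `[a - a ^ s,
  -- a + a ^ s]`, of logarithmic measure at most `4 * a ^ s / a = 4 * (a ^ τ) ^ (-p)`. This is
  -- summable over `k` because `p > 1`.
  have hlevel : ∀ k : ℕ, ∃ F : Set ℝ, MeasurableSet F ∧ F ⊆ Set.Ici 1 ∧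
      (∀ r, r₁ ≤ r → 2 * S r < S (r + r ^ s) → 2 ^ k ≤ S r → S r < 2 ^ (k + 1) → r ∈ F) ∧
      ∫⁻ r in F, ENNReal.ofReal (1 / r) ≤ ENNReal.ofReal (4 * ((k + 1) / D) ^ (-p)) := by
    intro k
    by_cases hne : ∃ a, r₁ ≤ a ∧ 2 * S a < S (a + a ^ s) ∧ 2 ^ k ≤ S a ∧ S a < 2 ^ (k + 1)
    swap
    · refine ⟨∅, MeasurableSet.empty, Set.empty_subset _, fun r h1 h2 h3 h4 => ?_, by simp⟩
      exact hne ⟨r, h1, h2, h3, h4⟩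
    obtain ⟨a, ha1, ha2, ha3, ha4⟩ := hne
    obtain ⟨⟨hb, hsm⟩, -, hone⟩ := hr₁ a ha1
    have ha0 : 0 < a := by linarith
    refine ⟨Set.Icc (a - a ^ s) (a + a ^ s) ∩ Set.Ici 1, measurableSet_Icc.inter measurableSet_Ici,
      Set.inter_subset_right, fun r h1 h2 h3 h4 => ?_,
      (lintegral_one_div_Icc_le ha0 hsm).trans ?_⟩
    · obtain ⟨⟨-, hsr⟩, -, honer⟩ := hr₁ r h1
      refine ⟨?_, honer⟩
      have e1 : r < a + a ^ s := by
        by_contra! hc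
        have := hmono hc
        rw [pow_succ] at h4
        linarith
      have e2 : a < r + r ^ s := by
        by_contra! hc
        have := hmono hc
        rw [pow_succ] at ha4
        linarith
      refine ⟨?_, e1.le⟩
      rcases le_total a r with har | har
      · linarith [Real.rpow_nonneg ha0.le s]
      · have := Real.rpow_le_rpow (by linarith) har hs0
        linarith
    · refine ENNReal.ofReal_le_ofReal (mul_le_mul_of_nonneg_left ?_ (by norm_num))
      have hk : (k : ℝ) * Real.log 2 ≤ Real.log C + a ^ τ := by
        have := Real.log_le_log (by positivity) (ha3.trans hb)
        rwa [Real.log_pow, Real.log_mul (by linarith) (Real.exp_ne_zero _), Real.log_exp] at this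
      have haτ : 1 ≤ a ^ τ := Real.one_le_rpow hone hτ.le
      have hkD : ((k : ℝ) + 1) / D ≤ a ^ τ := by
        rw [div_le_iff₀ hD0, hD, mul_add, mul_one, mul_div_assoc']
        refine add_le_add ?_ haτ
        rw [le_div_iff₀ hl2]
        nlinarith
      calc a ^ s / a = (a ^ τ) ^ (-p) := by
            rw [← Real.rpow_mul ha0.le, ← Real.rpow_sub_one ha0.ne', hp]
            congr 1
            field_simp
            ring
        _ ≤ _ := Real.rpow_le_rpow_of_nonpos (by positivity) hkD (by linarith)
  choose F hF1 hF2 hF3 hF4 using hlevel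
  refine ⟨⋃ k, F k, ⟨MeasurableSet.iUnion hF1, Set.iUnion_subset hF2, ?_⟩, ?_⟩
  · refine (lintegral_iUnion_le _ _).trans_lt ((ENNReal.tsum_le_tsum hF4).trans_lt ?_)
    apply Summable.tsum_ofReal_lt_top
    apply Summable.mul_left
    have h1 : Summable fun k : ℕ => (((k + 1 : ℕ) : ℝ)) ^ (-p) :=
      (summable_nat_add_iff 1).2 (Real.summable_nat_rpow.2 (by linarith))
    refine (h1.mul_right ((D ^ (-p))⁻¹)).congr fun k => ?_
    rw [Real.div_rpow (by positivity) hD0.le, div_eq_mul_inv]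
    push_cast
    rfl
  · filter_upwards [eventually_ge_atTop r₁] with r hr hrE
    by_contra! hc
    obtain ⟨k, hk1, hk2⟩ := exists_nat_pow_near (hr₁ r hr).2.1 (one_lt_two)
    exact hrE (Set.mem_iUnion.2 ⟨k, hF3 k r hr hc hk1 hk2⟩)

/-! ### Shift estimate and use of the hyper-order. -/

namespace IsPiecewisePolynomial

variable {n : ℕ} {f : ℝ → ℝ} {x : ℤ → ℝ} {p : ℤ → ℝ[X]}

theorem abs_shift_sub_le (h : IsPiecewisePolynomial n f x p) {r R d : ℝ} (hd : |d| ≤ r)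
    (hR : r + |d| < R) : |f (r + d) - f r| ≤ |d| / (R - r - |d|) * majorant n f R := by
  have hr : 0 ≤ r := (abs_nonneg d).trans hd
  have hden : 0 < R - r - |d| := by linarith
  rcases le_total 0 d with h0 | h0
  · rw [abs_of_nonneg h0] at hd hR ⊢
    have := h.abs_sub_le hr (by linarith : r ≤ r + d) hR
    rwa [add_sub_cancel_left, ← sub_sub] at this
  · rw [abs_of_nonpos h0] at hd hR hden ⊢
    rw [abs_sub_comm]
    refine (h.abs_sub_le (by linarith : 0 ≤ r + d) (by linarith : r + d ≤ r)
      (by linarith : r < R)).trans ?_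
    refine mul_le_mul_of_nonneg_right ?_ (majorant_nonneg _ _ _)
    rw [sub_add_cancel_left]
    exact div_le_div_of_nonneg_left (by linarith) hden (by linarith)

theorem proximity_shift_le (h : IsPiecewisePolynomial n f x p) {r R c : ℝ} (hc : |c| ≤ r)
    (hR : r + |c| < R) : proximity r (tropicalDiv (fun x => f (x + c)) f)
      ≤ |c| / (R - r - |c|) * majorant n f R := by
  have h1 := h.abs_shift_sub_le hc hR
  -- At `-r`, the reflected function is shifted by `-c`; its majorant is the same.
  have h2 := h.comp_neg.abs_shift_sub_le (r := r) (R := R) (d := -c) (by rwa [abs_neg]) (by rwa [abs_neg])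
  rw [abs_neg, h.majorant_comp_neg, neg_add, neg_neg] at h2
  have m1 := max_le (le_abs_self (f (r + c) - f r)) (abs_nonneg _)
  have m2 := max_le (le_abs_self (f (-r + c) - f (-r))) (abs_nonneg _)
  change (max (f (r + c) - f r) 0 + max (f (-r + c) - f (-r)) 0) / 2 ≤ _
  linarith

theorem characteristic_nonneg (h : IsPiecewisePolynomial n f x p) (r : ℝ) :
    0 ≤ characteristic n r f :=
  add_nonneg (proximity_nonneg r f)
    (Finset.sum_nonneg fun _ hj => h.counting_nonneg (Finset.mem_Icc.1 hj).1 r)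

/-- A hyper-order bound yields the growth bound `T(r, f) ≤ exp (r ^ τ)` with `τ > 0`. -/
theorem characteristic_le_exp (h : IsPiecewisePolynomial n f x p) (hn : 1 ≤ n) {τ : ℝ}
    (hτ : hyperOrder n f < (τ : EReal)) :
    0 < τ ∧ ∀ᶠ r in atTop, characteristic n r f ≤ Real.exp (r ^ τ) := by
  obtain ⟨K, hK, hKT⟩ := h.exists_majorant_le_mul hn
  -- Since the characteristic function tends to infinity, it eventually exceeds `exp 1`; both
  -- logarithms are then genuine and positive, which also forces `τ > 0`.
  have hev : ∀ᶠ r : ℝ in atTop,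
      Real.exp 1 < characteristic n r f ∧ 1 < r ∧
      Real.log (Real.log (characteristic n r f)) / Real.log r < τ := by
    filter_upwards [hKT, (h.tendsto_majorant hn).eventually_gt_atTop (K * Real.exp 1),
      eventually_gt_atTop 1, eventually_lt_of_limsup_lt hτ] with r h1 h2 h3 h4
    exact ⟨lt_of_mul_lt_mul_left (h2.trans_le h1) hK.le, h3, EReal.coe_lt_coe_iff.1 h4⟩
  have hlog : ∀ r : ℝ, Real.exp 1 < characteristic n r f → 1 < Real.log (characteristic n r f) :=
    fun r hr => (Real.lt_log_iff_exp_lt ((Real.exp_pos 1).trans hr)).2 hr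
  constructor
  · obtain ⟨r, h1, h2, h3⟩ := hev.exists
    exact (div_pos (Real.log_pos (hlog r h1)) (Real.log_pos h2)).trans h3
  · filter_upwards [hev] with r ⟨h1, h2, h3⟩
    have hT : 0 < characteristic n r f := (Real.exp_pos 1).trans h1
    have hL : 0 < Real.log (characteristic n r f) := by linarith [hlog r h1]
    rw [div_lt_iff₀ (Real.log_pos h2)] at h3
    rw [← Real.log_le_iff_le_exp hT, ← Real.log_le_log_iff hL (by positivity),
      Real.log_rpow (by linarith)]
    exact h3.le

end IsPiecewisePolynomial

theorem exists_real_between_of_lt_one_sub {ρ : EReal} {σ : ℝ} (h : (σ : EReal) < 1 - ρ) :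
    ∃ τ : ℝ, ρ < τ ∧ τ < 1 - σ := by
  have h1 : ρ < ((1 - σ : ℝ) : EReal) := by
    induction ρ with
    | bot => exact EReal.bot_lt_coe _
    | top => simp at h
    | coe a =>
      have : σ < 1 - a := by exact_mod_cast h
      exact EReal.coe_lt_coe_iff.2 (by linarith)
  obtain ⟨τ, h2, h3⟩ := EReal.lt_iff_exists_real_btwn.1 h1
  exact ⟨τ, h2, EReal.coe_lt_coe_iff.1 h3⟩

end TropicalNevanlinna

/-! ### Conclusion with `R = r + r ^ s`. -/

theorem corollary4p7 (n : ℕ) (hn : 1 ≤ n) (c : ℝ) (hc : c ≠ 0) (f : ℝ → ℝ)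
    (hf : TropicalNevanlinna.IsWellDefinedTropicalMeromorphic n f)
    (hρ : TropicalNevanlinna.hyperOrder n f < 1)
    (σ : ℝ) (hσ_pos : 0 < σ) (hσ_lt : (σ : EReal) < 1 - TropicalNevanlinna.hyperOrder n f) :
    ∃ E : Set ℝ, TropicalNevanlinna.HasFiniteLogMeasure E ∧
      (fun r : ℝ => TropicalNevanlinna.proximity r
          (TropicalNevanlinna.tropicalDiv (fun x => f (x + c)) f))
        =o[Filter.atTop ⊓ Filter.principal Eᶜ]
      (fun r : ℝ => TropicalNevanlinna.characteristic n r f / r ^ σ) := by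
  open TropicalNevanlinna in
  obtain ⟨x, p, h, -⟩ := hf
  obtain ⟨τ, hτρ, hτσ⟩ := exists_real_between_of_lt_one_sub hσ_lt
  obtain ⟨s, hs1, hs2⟩ := exists_between (show σ < 1 - τ by linarith)
  obtain ⟨hτ, hexp⟩ := h.characteristic_le_exp hn hτρ
  obtain ⟨K, hK, hKT⟩ := h.exists_majorant_le_mul hn
  have hs0 : 0 < s := hσ_pos.trans hs1
  have hbound : ∀ᶠ r in atTop, majorant n f r ≤ max K 1 * Real.exp (r ^ τ) := by
    filter_upwards [hKT, hexp] with r h1 h2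
    calc majorant n f r ≤ K * characteristic n r f := h1
      _ ≤ max K 1 * Real.exp (r ^ τ) :=
        mul_le_mul (le_max_left _ _) h2 (h.characteristic_nonneg r) (by positivity)
  obtain ⟨E, hE, hgrowth⟩ := exists_finite_log_measure_growth h.majorant_mono
    (h.tendsto_majorant hn) (le_max_right K 1) hτ hs0.le (by linarith) hbound
  refine ⟨E, hE, Asymptotics.isLittleO_iff.2 fun ε hε => ?_⟩
  rw [eventually_inf_principal]
  have hsmall : Tendsto (fun r : ℝ => 4 * |c| * K * r ^ (-(s - σ))) atTop (𝓝 0) := by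
    simpa using (tendsto_rpow_neg_atTop (sub_pos.2 hs1)).const_mul (4 * |c| * K)
  filter_upwards [hgrowth, hKT, hsmall.eventually_le_const hε, eventually_ge_atTop |c|,
    eventually_gt_atTop 0, (tendsto_rpow_atTop hs0).eventually_ge_atTop (2 * |c|)]
    with r h1 h2 h3 h4 h5 h6 hrE
  have hc0 : 0 < |c| := abs_pos.2 hc
  have hrs : 0 < r ^ s := Real.rpow_pos_of_pos h5 s
  have hT := h.characteristic_nonneg r
  rw [Real.norm_of_nonneg (proximity_nonneg _ _),
    Real.norm_of_nonneg (div_nonneg hT (Real.rpow_nonneg h5.le _))]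
  -- Uses `2 * |c| ≤ r ^ s`, so the fixed shift costs at most half of the gap.
  have hden : r ^ s / 2 ≤ r + r ^ s - r - |c| := by linarith
  calc proximity r (tropicalDiv (fun x => f (x + c)) f)
      ≤ |c| / (r + r ^ s - r - |c|) * majorant n f (r + r ^ s) :=
        h.proximity_shift_le h4 (by linarith)
    _ ≤ |c| / (r ^ s / 2) * (2 * (K * characteristic n r f)) :=
        mul_le_mul (div_le_div_of_nonneg_left hc0.le (by positivity) hden)
          ((h1 hrE).trans (by linarith)) (majorant_nonneg _ _ _) (by positivity)
    _ = 4 * |c| * K * r ^ (-(s - σ)) * (characteristic n r f / r ^ σ) := by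
        rw [show -(s - σ) = σ - s by ring, Real.rpow_sub h5]
        have := (Real.rpow_pos_of_pos h5 σ).ne'
        field_simp
        ring
    _ ≤ ε * (characteristic n r f / r ^ σ) := by
        gcongr
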